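/- **Conventions.** A TDLC group is a totally disconnected locally compact topological group. A *Cayley–Abels graph* of a TDLC group $G$ is a connected locally finite graph $X$ on which $G$ acts by automorphisms, transitively on vertices, with compact open vertex stabilizers; edges have length one. $G$ is *hyperbolic* if it is compactly generated and some Cayley–Abels graph of $G$ is Gromov hyperbolic. A subgroup $H\le G$ is *quasiconvex* if, in some Cayley–Abels graph $X$ of $G$, the orbit $Hv$ of some vertex $v$ is quasiconvex: there is $D\ge 0$ such that every geodesic of $X$ joining two points of $Hv$ lies in the $D$-neighbourhood of $Hv$. The *height* $\mathrm{ht}_G(H)$ is the largest $n$ for which there exist $n$ distinct cosets $g_1H,\dots,g_nH$ such that $\bigcap_{i=1}^n g_iHg_i^{-1}$ is non-compact; it is $\infty$ if such $n$ are unbounded, and $0$ if $H$ is compact. **Proposition.** Let $G$ be a hyperbolic TDLC group and let $H$ be an open quasiconvex subgroup of $G$. Then $\mathrm{ht}_G(H)<\infty$. -/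

import Mathlib

universe u

namespace TDLC

/-- A topological group is compactly generated if it is generated, as an abstract group, by a
compact subset. -/
def IsCompactlyGenerated (G : Type u) [Group G] [TopologicalSpace G] : Prop :=
  ∃ K : Set G, IsCompact K ∧ Subgroup.closure K = ⊤

/-- `X` is a Cayley–Abels graph of `G` (for the given action of `G` on the vertex set `V`): a
connected, locally finite graph on which `G` acts by graph automorphisms, transitively on the
vertices, with compact open vertex stabilizers. -/
structure IsCayleyAbelsGraph (G : Type u) [Group G] [TopologicalSpace G]
    {V : Type u} [MulAction G V] (X : SimpleGraph V) : Prop where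
  connected : X.Connected
  locallyFinite : ∀ v : V, (X.neighborSet v).Finite
  adj_smul : ∀ (g : G) (v w : V), X.Adj v w → X.Adj (g • v) (g • w)
  transitive : MulAction.IsPretransitive G V
  isCompact_stabilizer : ∀ v : V, IsCompact (MulAction.stabilizer G v : Set G)
  isOpen_stabilizer : ∀ v : V, IsOpen (MulAction.stabilizer G v : Set G)

/-- An edge path is a geodesic if its length is the distance between its endpoints. -/
def IsGeodesic {V : Type u} {X : SimpleGraph V} {x y : V} (p : X.Walk x y) : Prop :=
  p.length = X.dist x y

/-- Gromov hyperbolicity of a (connected) graph with edges of length one: for some `δ`, every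
geodesic triangle is `δ`-slim, i.e. each side lies in the `δ`-neighbourhood of the union of the
other two. (Triangles with corners at vertices suffice, since every point of the
graph is at distance at most `1/2` from a vertex; only the constant `δ` changes.) -/
def IsGromovHyperbolic {V : Type u} (X : SimpleGraph V) : Prop :=
  ∃ δ : ℕ, ∀ (x y z : V) (p : X.Walk x y) (q : X.Walk y z) (r : X.Walk x z),
    IsGeodesic p → IsGeodesic q → IsGeodesic r →
      ∀ v ∈ p.support, ∃ w : V, (w ∈ q.support ∨ w ∈ r.support) ∧ X.dist v w ≤ δ

/-- A set `Y` of vertices of a (connected) graph is quasiconvex if, for some `D`, every geodesic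
joining two points of `Y` lies in the `D`-neighbourhood of `Y`. -/
def IsQuasiconvexSet {V : Type u} (X : SimpleGraph V) (Y : Set V) : Prop :=
  ∃ D : ℕ, ∀ x ∈ Y, ∀ y ∈ Y, ∀ p : X.Walk x y, IsGeodesic p →
    ∀ v ∈ p.support, ∃ w ∈ Y, X.dist v w ≤ D

/-- A topological group (in practice a TDLC group) is hyperbolic if it is compactly generated and
some Cayley–Abels graph of it is Gromov hyperbolic. The vertex set of a Cayley–Abels graph is in
bijection with a quotient `G ⧸ U`, so vertex types in the universe of `G` are enough. -/
def IsHyperbolic (G : Type u) [Group G] [TopologicalSpace G] : Prop :=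
  IsCompactlyGenerated G ∧
    ∃ (V : Type u) (_ : MulAction G V) (X : SimpleGraph V),
      IsCayleyAbelsGraph G X ∧ IsGromovHyperbolic X

/-- A subgroup `H` of a (hyperbolic TDLC) group `G` is quasiconvex if, in some Cayley–Abels graph
`X` of `G`, the `H`-orbit of some vertex is a quasiconvex subset of `X`. -/
def IsQuasiconvex {G : Type u} [Group G] [TopologicalSpace G] (H : Subgroup G) : Prop :=
  ∃ (V : Type u) (_ : MulAction G V) (X : SimpleGraph V),
    IsCayleyAbelsGraph G X ∧ ∃ v : V, IsQuasiconvexSet X (MulAction.orbit H v)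

/-- The intersection of the conjugates `g i * H * (g i)⁻¹`. -/
def conjInter {G : Type u} [Group G] (H : Subgroup G) {n : ℕ} (g : Fin n → G) : Subgroup G :=
  ⨅ i, H.map (MulAut.conj (g i)).toMonoidHom

/-- The height of `H` in `G`, with value `⊤` if it is infinite: the largest `n` such that there are
`n` distinct cosets `g₁H, …, gₙH` for which the intersection of the conjugates `gᵢHgᵢ⁻¹` is not
compact. If `H` is compact and closed, no `n ≥ 1` qualifies and the supremum is `0`. -/
noncomputable def height {G : Type u} [Group G] [TopologicalSpace G] (H : Subgroup G) : ℕ∞ :=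
  ⨆ (n : ℕ) (_ : ∃ g : Fin n → G, Function.Injective (fun i => (g i : G ⧸ H)) ∧
    ¬ IsCompact (conjInter H g : Set G)), (n : ℕ∞)

end TDLC

/-! Fix a hyperbolic Cayley–Abels graph and a vertex `v`. A non-compact intersection of conjugates
is closed, so it contains `k` moving `v` arbitrarily far. Since `k * g i = g i * h` with `h ∈ H`,
the geodesics `[v, kv]` and `[g i v, g i h v]` are opposite sides of a quadrilateral whose other
sides have bounded length. A point of `[v, kv]` far from both ends is therefore close to the second
geodesic and, by quasiconvexity, to `g i H v`, for every `i` at once (`exists_near_translates`). As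
`H` is open, only boundedly many cosets can come that close to one vertex (`exists_card_le`).
Quasiconvexity may be given in another Cayley–Abels graph; stability of quasi-geodesics
(`exists_quasiGeodesic_bound`) transports it (`exists_dist_orbit_le`). -/

namespace TDLC

/-! ### Metric intervals and slim triangles -/

section Graph

variable {V : Type*} {X : SimpleGraph V}

/-- The metric interval between two vertices: `v` lies on some geodesic from `x` to `y`. -/
def Between (X : SimpleGraph V) (x v y : V) : Prop :=
  X.dist x v + X.dist v y = X.dist x y

/-- `δ`-slimness of triangles, phrased with metric intervals. -/
def IsSlim (X : SimpleGraph V) (δ : ℕ) : Prop :=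
  ∀ x y z v : V, Between X x v y →
    ∃ w, (Between X y w z ∨ Between X x w z) ∧ X.dist v w ≤ δ

theorem Between.symm {x v y : V} (h : Between X x v y) : Between X y v x := by
  unfold Between at *
  rw [X.dist_comm (u := y) (v := v), X.dist_comm (u := v) (v := x),
    X.dist_comm (u := y) (v := x)]
  omega

theorem between_left (X : SimpleGraph V) (x y : V) : Between X x x y := by
  simp [Between]

theorem between_self_iff (hX : X.Connected) {x v : V} : Between X x v x ↔ v = x := by
  unfold Between
  rw [SimpleGraph.dist_self]
  constructor
  · intro h
    exact (hX.dist_eq_zero_iff.1 (by omega : X.dist v x = 0))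
  · rintro rfl
    simp

theorem Between.dist_left_le {x v y : V} (h : Between X x v y) : X.dist x v ≤ X.dist x y := by
  unfold Between at h
  omega

theorem dist_getVert_le (hX : X.Connected) {x y : V} (p : X.Walk x y) (i n : ℕ) :
    X.dist (p.getVert i) (p.getVert (i + n)) ≤ n := by
  induction n with
  | zero => simp
  | succ n ih =>
    have h1 : X.dist (p.getVert (i + n)) (p.getVert (i + n + 1)) ≤ 1 := by
      rcases lt_or_ge (i + n) p.length with h | h
      · exact (SimpleGraph.dist_eq_one_iff_adj.2 (p.adj_getVert_succ h)).le
      · rw [p.getVert_of_length_le h, p.getVert_of_length_le (by omega)]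
        simp
    have h2 := hX.dist_triangle (u := p.getVert i) (v := p.getVert (i + n))
      (w := p.getVert (i + n + 1))
    rw [← add_assoc]
    omega

theorem IsGeodesic.le_dist_getVert (hX : X.Connected) {x y : V}
    {p : X.Walk x y} (hp : IsGeodesic p) {i n : ℕ} (h : i + n ≤ p.length) :
    n ≤ X.dist (p.getVert i) (p.getVert (i + n)) := by
  have h1 := dist_getVert_le hX p 0 i
  have h2 := dist_getVert_le hX p (i + n) (p.length - (i + n))
  rw [Nat.add_sub_cancel' h, p.getVert_length] at h2
  rw [zero_add, p.getVert_zero] at h1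
  have h3 := hX.dist_triangle (u := x) (v := p.getVert i) (w := y)
  have h4 := hX.dist_triangle (u := p.getVert i) (v := p.getVert (i + n)) (w := y)
  unfold IsGeodesic at hp
  omega

theorem IsGeodesic.between (hX : X.Connected) {x y : V}
    {p : X.Walk x y} (hp : IsGeodesic p) {v : V} (hv : v ∈ p.support) : Between X x v y := by
  obtain ⟨n, rfl, hn⟩ := SimpleGraph.Walk.mem_support_iff_exists_getVert.1 hv
  have h1 := dist_getVert_le hX p 0 n
  have h2 := dist_getVert_le hX p n (p.length - n)
  rw [Nat.add_sub_cancel' hn, p.getVert_length] at h2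
  rw [zero_add, p.getVert_zero] at h1
  have h3 := hX.dist_triangle (u := x) (v := p.getVert n) (w := y)
  unfold IsGeodesic at hp
  unfold Between
  omega

theorem Between.exists_geodesic (hX : X.Connected) {x v y : V}
    (h : Between X x v y) : ∃ p : X.Walk x y, IsGeodesic p ∧ v ∈ p.support := by
  obtain ⟨p, hp⟩ := hX.exists_walk_length_eq_dist x v
  obtain ⟨q, hq⟩ := hX.exists_walk_length_eq_dist v y
  refine ⟨p.append q, ?_, ?_⟩
  · unfold Between at h
    unfold IsGeodesic
    rw [SimpleGraph.Walk.length_append]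
    omega
  · rw [SimpleGraph.Walk.mem_support_append_iff]
    exact Or.inl p.end_mem_support

theorem exists_between_dist_eq (hX : X.Connected) {x y : V} {t : ℕ} (ht : t ≤ X.dist x y) :
    ∃ v, Between X x v y ∧ X.dist x v = t := by
  obtain ⟨p, hp⟩ := hX.exists_walk_length_eq_dist x y
  have h1 := dist_getVert_le hX p 0 t
  have h2 := dist_getVert_le hX p t (p.length - t)
  rw [Nat.add_sub_cancel' (by omega), p.getVert_length] at h2
  rw [zero_add, p.getVert_zero] at h1
  have h3 := hX.dist_triangle (u := x) (v := p.getVert t) (w := y)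
  refine ⟨p.getVert t, ?_, by omega⟩
  unfold Between
  omega

theorem IsGromovHyperbolic.exists_isSlim (hX : X.Connected)
    (h : IsGromovHyperbolic X) : ∃ δ, IsSlim X δ := by
  obtain ⟨δ, hδ⟩ := h
  refine ⟨δ, fun x y z v hv => ?_⟩
  obtain ⟨p, hp, hvp⟩ := hv.exists_geodesic hX
  obtain ⟨q, hq⟩ := hX.exists_walk_length_eq_dist y z
  obtain ⟨r, hr⟩ := hX.exists_walk_length_eq_dist x z
  obtain ⟨w, hw, hvw⟩ := hδ x y z p q r hp hq hr v hvp
  exact ⟨w, hw.imp (fun h => IsGeodesic.between hX hq h) (fun h => IsGeodesic.between hX hr h),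
    hvw⟩

/-- In a slim quadrilateral `x, y, z, t`, each point of `[x, y]` is close to the other sides. -/
theorem IsSlim.quadrilateral (hX : X.Connected) {δ : ℕ} (hδ : IsSlim X δ) (x y z t : V) {v : V}
    (hv : Between X x v y) :
    ∃ w, (Between X x w t ∨ Between X t w z ∨ Between X y w z) ∧ X.dist v w ≤ 2 * δ := by
  obtain ⟨w, hw | hw, hvw⟩ := hδ x y z v hv
  · exact ⟨w, Or.inr (Or.inr hw), by omega⟩
  · obtain ⟨w', hw', hww'⟩ := hδ x z t w hw
    have := hX.dist_triangle (u := v) (v := w) (w := w')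
    exact ⟨w', hw'.elim (fun h => Or.inr (Or.inl h.symm)) Or.inl, by omega⟩

/-! ### Stability of quasi-geodesics -/

/-- Geodesics in a hyperbolic graph are logarithmically close to any coarse path with the same
endpoints. -/
theorem IsSlim.exists_dist_le_log (hX : X.Connected) {δ L : ℕ} (hδ : IsSlim X δ) (k : ℕ) :
    ∀ (N : ℕ) (z : ℕ → V) (p : V), N ≤ 2 ^ k → (∀ i < N, X.dist (z i) (z (i + 1)) ≤ L) →
      Between X (z 0) p (z N) → ∃ i ≤ N, X.dist p (z i) ≤ δ * k + L := by
  induction k with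
  | zero =>
    intro N z p hN hz hp
    refine ⟨0, Nat.zero_le _, ?_⟩
    have h1 : X.dist (z 0) (z N) ≤ L := by
      obtain rfl | rfl : N = 0 ∨ N = 1 := by
        rw [pow_zero] at hN
        omega
      · simp
      · exact hz 0 one_pos
    have := hp.dist_left_le
    rw [X.dist_comm]
    omega
  | succ k ih =>
    intro N z p hN hz hp
    rcases le_total N (2 ^ k) with h | h
    · obtain ⟨i, hi, hpi⟩ := ih N z p h hz hp
      exact ⟨i, hi, by rw [Nat.mul_succ]; omega⟩
    -- Splitting the path at index `2 ^ k` costs one slim triangle, hence `δ` per halving.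
    · obtain ⟨w, hw, hpw⟩ := hδ _ _ (z (2 ^ k)) _ hp
      suffices ∃ i ≤ N, X.dist w (z i) ≤ δ * k + L by
        obtain ⟨i, hi, hwi⟩ := this
        have := hX.dist_triangle (u := p) (v := w) (w := z i)
        exact ⟨i, hi, by rw [Nat.mul_succ]; omega⟩
      rcases hw with hw | hw
      · rw [pow_succ] at hN
        obtain ⟨i, hi, hwi⟩ := ih (N - 2 ^ k) (fun i => z (2 ^ k + i)) w (by omega)
          (fun i hi => hz _ (by omega))
          (by simpa only [add_zero, Nat.add_sub_cancel' h] using hw.symm)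
        exact ⟨2 ^ k + i, by omega, hwi⟩
      · obtain ⟨i, hi, hwi⟩ := ih (2 ^ k) z w le_rfl (fun i hi => hz i (by omega)) hw
        exact ⟨i, by omega, hwi⟩

theorem exists_linear_le_two_pow (a b : ℕ) : ∃ k₁, ∀ k ≥ k₁, a * k + b ≤ 2 ^ k := by
  have sq_le : ∀ k ≥ 4, k ^ 2 ≤ 2 ^ k := by
    intro k hk
    induction k, hk using Nat.le_induction with
    | base => norm_num
    | succ k hk ih =>
      rw [pow_succ 2 k]
      nlinarith
  refine ⟨a + b + 4, fun k hk => le_trans ?_ (sq_le k (by omega))⟩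
  nlinarith

/-- A number bounded by a logarithm of a linear function of itself is bounded. This closes the
self-referential estimate in the stability theorem. -/
theorem exists_bound_of_le_log (A B C δ : ℕ) :
    ∃ R, ∀ D, (∀ k, A * D + B ≤ 2 ^ k → D ≤ δ * k + C) → D ≤ R := by
  obtain ⟨k₁, hk₁⟩ := exists_linear_le_two_pow (A * δ) (A * δ + A * C + B)
  refine ⟨δ * k₁ + C, fun D hD => ?_⟩
  by_contra hlt
  have h0 : 2 ^ k₁ < A * D + B := by
    by_contra h
    exact hlt (hD k₁ (not_lt.1 h))
  have hc := hD _ (Nat.le_pow_clog one_lt_two (A * D + B))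
  have hk : k₁ < Nat.clog 2 (A * D + B) := (Nat.lt_clog_iff_pow_lt one_lt_two).2 h0
  obtain ⟨k, hk'⟩ : ∃ k, Nat.clog 2 (A * D + B) = k + 1 := ⟨Nat.clog 2 (A * D + B) - 1, by omega⟩
  rw [hk'] at hc
  have h1 : 2 ^ k < A * D + B := (Nat.lt_clog_iff_pow_lt one_lt_two).1 (by omega)
  have h2 := hk₁ k (by omega)
  have h3 : A * D ≤ A * (δ * (k + 1) + C) := Nat.mul_le_mul_left _ hc
  have h4 : A * (δ * (k + 1) + C) = A * δ * k + A * δ + A * C := by ring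
  omega

/-- A geodesic in a hyperbolic graph lies in a uniform neighbourhood of any quasi-geodesic with the
same endpoints. -/
theorem IsSlim.exists_quasiGeodesic_bound (hX : X.Connected) {δ : ℕ} (hδ : IsSlim X δ)
    (L A B : ℕ) : ∃ R, ∀ (N : ℕ) (z : ℕ → V) (p : V),
      (∀ i < N, X.dist (z i) (z (i + 1)) ≤ L) →
      (∀ i n, i + n ≤ N → n ≤ A * X.dist (z i) (z (i + n)) + B) →
      Between X (z 0) p (z N) → ∃ i ≤ N, X.dist p (z i) ≤ R := by
  obtain ⟨R, hR⟩ := exists_bound_of_le_log (6 * A) B (2 * δ + L) δ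
  refine ⟨R, fun N z p hL hA hp => ?_⟩
  classical
  have hex : ∃ D, ∀ q, Between X (z 0) q (z N) → ∃ i ≤ N, X.dist q (z i) ≤ D :=
    ⟨X.dist (z 0) (z N), fun q hq => ⟨0, Nat.zero_le _, by
      rw [X.dist_comm]; exact hq.dist_left_le⟩⟩
  -- By minimality of `D`, some `q` on the geodesic is at distance at least `D` from the whole path.
  obtain ⟨D, hD, hmin⟩ : ∃ D, (∀ q, Between X (z 0) q (z N) → ∃ i ≤ N, X.dist q (z i) ≤ D) ∧
      ∀ D' < D, ¬ ∀ q, Between X (z 0) q (z N) → ∃ i ≤ N, X.dist q (z i) ≤ D' :=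
    ⟨Nat.find hex, Nat.find_spec hex, fun D' h => Nat.find_min hex h⟩
  suffices hDR : D ≤ R by
    obtain ⟨i, hi, h⟩ := hD p hp
    exact ⟨i, hi, h.trans hDR⟩
  apply hR
  intro k hk
  rcases Nat.eq_zero_or_pos D with rfl | hpos
  · exact Nat.zero_le _
  have hfar : ∃ q, Between X (z 0) q (z N) ∧ ∀ i ≤ N, D ≤ X.dist q (z i) := by
    have := hmin (D - 1) (by omega)
    push Not at this
    obtain ⟨q, hq, h⟩ := this
    exact ⟨q, hq, fun i hi => by have := h i hi; omega⟩
  obtain ⟨q, hq, hfar⟩ := hfar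
  have hlog : ∀ i n w, i + n ≤ N → X.dist (z i) (z (i + n)) ≤ 6 * D →
      Between X (z i) w (z (i + n)) → X.dist q w ≤ 2 * δ → D ≤ δ * k + (2 * δ + L) := by
    intro i n w hn hd hw hqw
    have h1 : n ≤ 2 ^ k := by
      have h2 := hA i n hn
      have h3 : A * X.dist (z i) (z (i + n)) ≤ A * (6 * D) := Nat.mul_le_mul_left _ hd
      have h4 : A * (6 * D) = 6 * A * D := by ring
      omega
    obtain ⟨l, hl, hwl⟩ := hδ.exists_dist_le_log hX (L := L) k n (fun l => z (i + l)) w h1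
      (fun l hl => hL _ (by omega)) hw
    have h2 := hfar (i + l) (by omega)
    have h3 := hX.dist_triangle (u := q) (v := w) (w := z (i + l))
    omega
  -- Go back from `q` by `2 * D` towards the end `z e`, or to `z e` itself if it is nearer. A
  -- geodesic of length at most `D` from there to the path stays `D` away from `q`.
  have hside : ∀ e m, e ≤ N → (∀ y, Between X (z e) y q → Between X (z 0) y (z N)) →
      m = X.dist (z e) q → ∃ y, Between X (z e) y q ∧ X.dist y q ≤ 2 * D ∧ ∃ i ≤ N,
        X.dist y (z i) ≤ D ∧ ∀ w, Between X y w (z i) → D ≤ X.dist q w := by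
    intro e m he hsub hm
    rcases le_total m (2 * D) with h | h
    · refine ⟨z e, between_left _ _ _, by omega, e, he, by simp, fun w hw => ?_⟩
      rw [(between_self_iff hX).1 hw]
      exact hfar e he
    · obtain ⟨y, hy, hyd⟩ := exists_between_dist_eq hX (x := z e) (y := q) (t := m - 2 * D)
        (by omega)
      obtain ⟨i, hi, hyi⟩ := hD y (hsub y hy)
      have hyq : X.dist y q = 2 * D := by unfold Between at hy; omega
      refine ⟨y, hy, hyq.le, i, hi, hyi, fun w hw => ?_⟩
      have h1 := hw.dist_left_le
      have h2 := hX.dist_triangle (u := y) (v := w) (w := q)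
      rw [X.dist_comm (u := w)] at h2
      omega
  obtain ⟨y₁, hy₁, hd₁, i, hi, hyi, hwi⟩ := hside 0 _ (Nat.zero_le _) (fun y hy => by
    have h1 := hX.dist_triangle (u := y) (v := q) (w := z N)
    have h2 := hX.dist_triangle (u := z 0) (v := y) (w := z N)
    unfold Between at *; omega) rfl
  obtain ⟨y₂, hy₂, hd₂, j, hj, hyj, hwj⟩ := hside N _ le_rfl (fun y hy => by
    have h1 := hX.dist_triangle (u := z 0) (v := q) (w := y)
    have h2 := hX.dist_triangle (u := z 0) (v := y) (w := z N)
    have h3 := hy.symm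
    unfold Between at *; omega) rfl
  have hq' : Between X y₁ q y₂ := by
    have h1 := hX.dist_triangle (u := y₁) (v := q) (w := y₂)
    have h2 := hX.dist_triangle (u := z 0) (v := y₁) (w := z N)
    have h3 := hX.dist_triangle (u := y₁) (v := y₂) (w := z N)
    have h4 := hy₂.symm
    unfold Between at *; omega
  -- `6 * D = D + 2 * D + 2 * D + D`, along `z i`, `y₁`, `q`, `y₂`, `z j`.
  have hij : X.dist (z i) (z j) ≤ 6 * D := by
    have h1 := hX.dist_triangle (u := z i) (v := y₁) (w := z j)
    have h2 := hX.dist_triangle (u := y₁) (v := q) (w := z j)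
    have h3 := hX.dist_triangle (u := q) (v := y₂) (w := z j)
    rw [X.dist_comm (u := z i) (v := y₁)] at h1
    rw [X.dist_comm (u := q) (v := y₂)] at h3
    omega
  obtain ⟨w, hw, hqw⟩ := hδ.quadrilateral hX y₁ y₂ (z j) (z i) hq'
  rcases hw with hw | hw | hw
  · have := hwi w hw
    omega
  · rcases le_total i j with h | h
    · obtain ⟨n, rfl⟩ := Nat.exists_eq_add_of_le h
      exact hlog i n w hj hij hw hqw
    · obtain ⟨n, rfl⟩ := Nat.exists_eq_add_of_le h
      exact hlog j n w hi (by rwa [X.dist_comm]) hw.symm hqw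
  · have := hwj w hw
    omega

theorem finite_setOf_dist_le (hX : X.Connected) (hfin : ∀ v, (X.neighborSet v).Finite) (v : V)
    (n : ℕ) : {w | X.dist v w ≤ n}.Finite := by
  induction n with
  | zero =>
    refine (Set.finite_singleton v).subset fun w hw => ?_
    exact (hX.dist_eq_zero_iff.1 (Nat.le_zero.1 hw)).symm
  | succ n ih =>
    refine (ih.union (ih.biUnion fun u _ => hfin u)).subset fun w hw => ?_
    rcases Nat.lt_or_ge n (X.dist v w) with h | h
    · obtain ⟨u, hu, hd⟩ := exists_between_dist_eq hX (t := n) h.le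
      have hw : X.dist v w ≤ n + 1 := hw
      refine Or.inr (Set.mem_biUnion (x := u) hd.le ?_)
      refine SimpleGraph.dist_eq_one_iff_adj.1 ?_
      unfold Between at hu
      omega
    · exact Or.inl h

end Graph

/-! ### Compact sets and open subgroups -/

section Group

variable {G : Type*} [Group G] [TopologicalSpace G]

theorem finite_image_mk_of_isCompact [IsTopologicalGroup G] {U : Subgroup G}
    (hU : IsOpen (U : Set G)) {E : Set G} (hE : IsCompact E) :
    ((QuotientGroup.mk : G → G ⧸ U) '' E).Finite := by
  have := QuotientGroup.discreteTopology hU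
  exact (hE.image QuotientGroup.continuous_mk).finite_of_discrete

theorem isCompact_setOf_smul_mem [IsTopologicalGroup G] {V : Type*} [MulAction G V] {v : V}
    (hv : IsCompact (MulAction.stabilizer G v : Set G)) {F : Set V} (hF : F.Finite) :
    IsCompact {g : G | g • v ∈ F} := by
  have : {g : G | g • v ∈ F} = ⋃ w ∈ F, {g : G | g • v = w} := by
    ext g
    simp
  rw [this]
  refine hF.isCompact_biUnion fun w _ => ?_
  by_cases h : ∃ g₀ : G, g₀ • v = w
  · obtain ⟨g₀, rfl⟩ := h
    convert hv.image (continuous_const_mul g₀) using 1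
    ext g
    simp only [Set.mem_ofPred_eq, Set.mem_image, SetLike.mem_coe, MulAction.mem_stabilizer_iff]
    constructor
    · intro h
      exact ⟨g₀⁻¹ * g, by rw [mul_smul, h, inv_smul_smul], by group⟩
    · rintro ⟨s, hs, rfl⟩
      rw [mul_smul, hs]
  · convert isCompact_empty
    ext g
    simpa using fun hg => h ⟨g, hg⟩

theorem isClosed_conjInter [IsTopologicalGroup G] {H : Subgroup G} (hH : IsOpen (H : Set G))
    {n : ℕ} (g : Fin n → G) : IsClosed (conjInter H g : Set G) := by
  unfold conjInter
  rw [Subgroup.coe_iInf]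
  refine isClosed_iInter fun i => ?_
  have : ((H.map (MulAut.conj (g i)).toMonoidHom : Subgroup G) : Set G) =
      (fun x => (g i)⁻¹ * x * g i) ⁻¹' H := by
    ext x
    rw [SetLike.mem_coe, Subgroup.mem_map_equiv]
    simp
  rw [this]
  exact (H.isClosed_of_isOpen hH).preimage (by fun_prop)

/-! ### Geometry of Cayley–Abels graphs -/

namespace IsCayleyAbelsGraph

variable {G V W : Type u} [Group G] [TopologicalSpace G] [MulAction G V] [MulAction G W]
  {X : SimpleGraph V} {Y : SimpleGraph W}

theorem dist_smul (hX : IsCayleyAbelsGraph G X) (g : G) (v w : V) :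
    X.dist (g • v) (g • w) = X.dist v w := by
  have key : ∀ (g : G) (v w : V), X.dist (g • v) (g • w) ≤ X.dist v w := by
    intro g v w
    obtain ⟨p, hp⟩ := hX.connected.exists_walk_length_eq_dist v w
    let f : X →g X := ⟨fun x => g • x, fun h => hX.adj_smul g _ _ h⟩
    rw [← hp, ← SimpleGraph.Walk.length_map f p]
    exact SimpleGraph.dist_le _
  refine le_antisymm (key g v w) ?_
  have := key g⁻¹ (g • v) (g • w)
  rwa [inv_smul_smul, inv_smul_smul] at this

theorem isCompact_setOf_dist_smul_le [IsTopologicalGroup G] (hX : IsCayleyAbelsGraph G X)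
    (v w : V) (n : ℕ) : IsCompact {g : G | X.dist v (g • w) ≤ n} :=
  isCompact_setOf_smul_mem (hX.isCompact_stabilizer w)
    (finite_setOf_dist_le hX.connected hX.locallyFinite v n)

/-- The displacement of `v` factors through the discrete quotient by its stabilizer, where compact
sets have finite image. -/
theorem exists_dist_smul_le_of_isCompact [IsTopologicalGroup G] (hX : IsCayleyAbelsGraph G X)
    (v : V) {E : Set G} (hE : IsCompact E) : ∃ l, ∀ g ∈ E, X.dist v (g • v) ≤ l := by
  have hfin := finite_image_mk_of_isCompact (hX.isOpen_stabilizer v) hE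
  have hfin' := hfin.image
    fun q : G ⧸ MulAction.stabilizer G v => X.dist v (MulAction.ofQuotientStabilizer G v q)
  obtain ⟨l, hl⟩ := hfin'.bddAbove
  exact ⟨l, fun g hg => hl ⟨_, ⟨g, hg, rfl⟩, rfl⟩⟩

/-- Orbit maps of two Cayley–Abels graphs are coarsely Lipschitz with respect to each other. -/
theorem exists_dist_le_mul_dist [IsTopologicalGroup G] (hX : IsCayleyAbelsGraph G X)
    (hY : IsCayleyAbelsGraph G Y) (v : V) (w : W) :
    ∃ l, ∀ g g' : G, X.dist (g • v) (g' • v) ≤ l * (Y.dist (g • w) (g' • w) + 1) := by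
  obtain ⟨l, hl⟩ := hX.exists_dist_smul_le_of_isCompact v (hY.isCompact_setOf_dist_smul_le w w 1)
  have hstep : ∀ g g' : G, Y.dist (g • w) (g' • w) ≤ 1 → X.dist (g • v) (g' • v) ≤ l := by
    intro g g' h
    have h1 := hl (g⁻¹ * g') (by
      rw [Set.mem_ofPred_eq, ← hY.dist_smul g, smul_smul, mul_inv_cancel_left]
      exact h)
    rwa [← hX.dist_smul g, smul_smul, mul_inv_cancel_left] at h1
  have hind : ∀ n, ∀ g g' : G, Y.dist (g • w) (g' • w) ≤ n →
      X.dist (g • v) (g' • v) ≤ l * (n + 1) := by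
    intro n
    induction n with
    | zero =>
      intro g g' h
      simpa using hstep g g' (by omega)
    | succ n ih =>
      intro g g' h
      rcases Nat.lt_or_ge n (Y.dist (g • w) (g' • w)) with h' | h'
      · obtain ⟨u, hu, hd⟩ := exists_between_dist_eq hY.connected (t := n) h'.le
        obtain ⟨k, rfl⟩ := hY.transitive.exists_smul_eq w u
        have h1 := ih g k hd.le
        have h2 := hstep k g' (by unfold Between at hu; omega)
        have h3 := hX.connected.dist_triangle (u := g • v) (v := k • v) (w := g' • v)
        rw [Nat.mul_succ]
        omega
      · exact (ih g g' h').trans (Nat.mul_le_mul_left _ (by omega))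
  exact ⟨l, fun g g' => hind _ g g' le_rfl⟩

/-- If an orbit of `H` is quasiconvex in some Cayley–Abels graph, then all orbits of `H` are
quasiconvex in each hyperbolic Cayley–Abels graph. -/
theorem exists_dist_orbit_le [IsTopologicalGroup G] (hX : IsCayleyAbelsGraph G X)
    (hY : IsCayleyAbelsGraph G Y) {δ : ℕ} (hδ : IsSlim X δ) {H : Subgroup G} {w : W}
    (hq : IsQuasiconvexSet Y (MulAction.orbit H w)) (v : V) :
    ∃ R, ∀ h ∈ H, ∀ h' ∈ H, ∀ p, Between X (h • v) p (h' • v) →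
      ∃ k ∈ H, X.dist p (k • v) ≤ R := by
  obtain ⟨D, hD⟩ := hq
  obtain ⟨l, hl⟩ := hX.exists_dist_le_mul_dist hY v w
  obtain ⟨A, hA⟩ := hY.exists_dist_le_mul_dist hX w v
  obtain ⟨R, hR⟩ := hδ.exists_quasiGeodesic_bound hX.connected (l * 2) A (A + 1)
  refine ⟨R + l * (D + 1), fun h hh h' hh' p hp => ?_⟩
  obtain ⟨c, hc⟩ := hY.connected.exists_walk_length_eq_dist (h • w) (h' • w)
  -- The extra index `c.length + 1` repeats the last vertex: `h` and `h'` may differ even when `c`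
  -- has length zero, so they need separate indices.
  have hex : ∀ i, ∃ g : G, g • w = c.getVert i ∧ (i = 0 → g = h) ∧ (i = c.length + 1 → g = h') := by
    intro i
    by_cases h0 : i = 0
    · exact ⟨h, by rw [h0, c.getVert_zero], fun _ => rfl, by omega⟩
    by_cases h1 : i = c.length + 1
    · exact ⟨h', by rw [h1, c.getVert_of_length_le (by omega)], by omega, fun _ => rfl⟩
    · obtain ⟨g, hg⟩ := hY.transitive.exists_smul_eq w (c.getVert i)
      exact ⟨g, hg, by omega, by omega⟩
  choose u hu hu0 huN using hex
  obtain ⟨i, hi, hpi⟩ := hR (c.length + 1) (fun i => u i • v) p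
    (fun i hi => by
      refine (hl _ _).trans (Nat.mul_le_mul_left _ ?_)
      rw [hu, hu]
      have := dist_getVert_le hY.connected c i 1
      omega)
    (fun i n hn => by
      have h1 := hA (u i) (u (i + n))
      rw [hu, hu] at h1
      rw [Nat.mul_succ] at h1
      rcases Nat.lt_or_ge c.length (i + n) with h2 | h2
      · rcases Nat.eq_zero_or_pos n with rfl | h3
        · exact Nat.zero_le _
        · have h4 := IsGeodesic.le_dist_getVert hY.connected (p := c) hc (i := i) (n := n - 1)
            (by omega)
          rw [c.getVert_of_length_le h2.le] at h1
          rw [c.getVert_of_length_le (by omega : c.length ≤ i + (n - 1))] at h4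
          omega
      · have h4 := IsGeodesic.le_dist_getVert hY.connected (p := c) hc h2
        omega)
    (by
      rw [hu0 0 rfl, huN _ rfl]
      exact hp)
  obtain ⟨_, ⟨k, rfl⟩, hk⟩ := hD (h • w) ⟨⟨h, hh⟩, rfl⟩ (h' • w) ⟨⟨h', hh'⟩, rfl⟩ c hc (c.getVert i)
    (c.getVert_mem_support i)
  refine ⟨k, k.2, ?_⟩
  have h1 := hl (u i) k
  rw [hu] at h1
  have h2 : l * (Y.dist (c.getVert i) ((k : G) • w) + 1) ≤ l * (D + 1) :=
    Nat.mul_le_mul_left _ (Nat.succ_le_succ hk)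
  have h3 := hX.connected.dist_triangle (u := p) (v := u i • v) (w := (k : G) • v)
  omega

/-- A point far from both ends of a long geodesic `[v, kv]`, with `k` in the intersection of the
conjugates of `H` by the `g i`, is uniformly close to all the translates `g i H v`. -/
theorem exists_near_translates [IsTopologicalGroup G] (hX : IsCayleyAbelsGraph G X) {δ : ℕ}
    (hδ : IsSlim X δ) {H : Subgroup G} (hHo : IsOpen (H : Set G)) {v : V} {R : ℕ}
    (hR : ∀ h ∈ H, ∀ h' ∈ H, ∀ p, Between X (h • v) p (h' • v) → ∃ k ∈ H, X.dist p (k • v) ≤ R)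
    {n : ℕ} {g : Fin n → G} (hg : ¬ IsCompact (conjInter H g : Set G)) :
    ∃ m : V, ∀ i, ∃ h ∈ H, X.dist m ((g i * h) • v) ≤ 2 * δ + R := by
  obtain ⟨C, hC⟩ : ∃ C, ∀ i, X.dist v (g i • v) ≤ C :=
    ⟨Finset.univ.sup fun i => X.dist v (g i • v), fun i =>
      Finset.le_sup (f := fun i => X.dist v (g i • v)) (Finset.mem_univ i)⟩
  -- Points of the short sides are within `C` of `v` or `k • v`, so distance `C + 2 * δ + 1` from
  -- both ends rules those sides out.
  obtain ⟨k, hk, hfar⟩ : ∃ k ∈ conjInter H g, 2 * (C + 2 * δ + 1) ≤ X.dist v (k • v) := by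
    by_contra! hcon
    exact hg ((hX.isCompact_setOf_dist_smul_le v v (2 * (C + 2 * δ + 1))).of_isClosed_subset
      (isClosed_conjInter hHo g) fun k hk => (hcon k hk).le)
  obtain ⟨m, hm, hmd⟩ := exists_between_dist_eq hX.connected (x := v) (y := k • v)
    (t := C + 2 * δ + 1) (by omega)
  refine ⟨m, fun i => ?_⟩
  obtain ⟨h, hh, hki⟩ : ∃ h ∈ H, k * g i = g i * h := by
    have := (Subgroup.mem_iInf.1 hk) i
    obtain ⟨h, hh, rfl⟩ := Subgroup.mem_map.1 this
    exact ⟨h, hh, by simp⟩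
  have hend : X.dist (k • v) ((g i * h) • v) ≤ C := by
    rw [← hki, mul_smul, hX.dist_smul]
    exact hC i
  have hmk : C + 2 * δ + 1 ≤ X.dist m (k • v) := by unfold Between at hm; omega
  obtain ⟨q, hq, hmq⟩ := hδ.quadrilateral hX.connected v (k • v) ((g i * h) • v) (g i • v) hm
  rcases hq with hq | hq | hq
  · have h1 := hq.dist_left_le
    have h2 := hC i
    have h3 := hX.connected.dist_triangle (u := v) (v := q) (w := m)
    rw [X.dist_comm (u := q)] at h3
    omega
  · have hq' : Between X ((1 : G) • v) ((g i)⁻¹ • q) (h • v) := by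
      unfold Between at *
      rw [← hX.dist_smul (g i), ← hX.dist_smul (g i) _ (h • v), ← hX.dist_smul (g i) _ (h • v),
        smul_inv_smul, one_smul, smul_smul]
      exact hq
    obtain ⟨h', hh', hd⟩ := hR 1 H.one_mem h hh _ hq'
    refine ⟨h', hh', ?_⟩
    rw [← hX.dist_smul (g i), smul_inv_smul, smul_smul] at hd
    have := hX.connected.dist_triangle (u := m) (v := q) (w := (g i * h') • v)
    omega
  · have h1 := hq.dist_left_le
    have h3 := hX.connected.dist_triangle (u := m) (v := q) (w := k • v)
    rw [X.dist_comm (u := q)] at h3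
    omega

theorem exists_card_le [IsTopologicalGroup G] (hX : IsCayleyAbelsGraph G X) {H : Subgroup G}
    (hHo : IsOpen (H : Set G)) (v : V) (R : ℕ) :
    ∃ N, ∀ (n : ℕ) (g : Fin n → G), Function.Injective (fun i => (g i : G ⧸ H)) →
      (∃ m : V, ∀ i, ∃ h ∈ H, X.dist m ((g i * h) • v) ≤ R) → n ≤ N := by
  have hfin := finite_image_mk_of_isCompact hHo (hX.isCompact_setOf_dist_smul_le v v R)
  refine ⟨((QuotientGroup.mk : G → G ⧸ H) '' {g : G | X.dist v (g • v) ≤ R}).ncard, ?_⟩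
  rintro n g hinj ⟨m, hm⟩
  -- Moving `m` to `v` makes the bound independent of `m` and `g`.
  obtain ⟨γ, rfl⟩ := hX.transitive.exists_smul_eq v m
  have hmem : ∀ i, γ⁻¹ • (g i : G ⧸ H) ∈
      (QuotientGroup.mk : G → G ⧸ H) '' {g : G | X.dist v (g • v) ≤ R} := by
    intro i
    obtain ⟨h, hh, hd⟩ := hm i
    refine ⟨γ⁻¹ * (g i * h), ?_, ?_⟩
    · rw [Set.mem_ofPred_eq, ← hX.dist_smul γ, smul_smul, mul_inv_cancel_left]
      exact hd
    · rw [MulAction.Quotient.smul_coe, smul_eq_mul, ← mul_assoc, QuotientGroup.mk_mul_of_mem _ hh]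
  have hinj' : Function.Injective fun i => γ⁻¹ • (g i : G ⧸ H) :=
    (MulAction.injective γ⁻¹).comp hinj
  have := Set.ncard_le_ncard (Set.range_subset_iff.2 hmem) hfin
  rwa [← Set.image_univ, Set.ncard_image_of_injective _ hinj', Set.ncard_univ, Nat.card_fin] at this

end IsCayleyAbelsGraph

end Group

end TDLC

theorem proposition3p15 (G : Type*) [Group G] [TopologicalSpace G] [IsTopologicalGroup G]
    [LocallyCompactSpace G] [TotallyDisconnectedSpace G] (hG : TDLC.IsHyperbolic G)
    (H : Subgroup G) (hHo : IsOpen (H : Set G)) (hHq : TDLC.IsQuasiconvex H) :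
    TDLC.height H < ⊤ := by
  obtain ⟨-, V, _, X, hX, hyp⟩ := hG
  obtain ⟨W, _, Y, hY, w, hq⟩ := hHq
  obtain ⟨δ, hδ⟩ := hyp.exists_isSlim hX.connected
  obtain ⟨v⟩ := hX.connected.nonempty
  obtain ⟨R, hR⟩ := hX.exists_dist_orbit_le hY hδ hq v
  obtain ⟨N, hN⟩ := hX.exists_card_le hHo v (2 * δ + R)
  refine lt_of_le_of_lt (iSup₂_le fun n hn => ?_) (ENat.natCast_lt_top N)
  obtain ⟨g, hinj, hg⟩ := hn
  exact Nat.cast_le.2 (hN n g hinj (hX.exists_near_translates hδ hHo hR hg))
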